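/- Let $D$ be a finite strict digraph (no loops, no parallel arcs), let $S\subseteq V(D)$, and let $H=D\langle S\rangle$ be the subdigraph of $D$ induced by $S$. Two vertices $u,v$ are called adjacent if $(u,v)$ or $(v,u)$ is an arc. Let $M$ be a maximum matching of $H$ (that is, of the underlying simple graph of $H$), with $|M|=m>0$, let $V(M)$ be the set of vertices covered by $M$, and let $X=S\setminus V(M)$. For $x\in X$ let $M_x$ be the set of edges of $M$ that have at least one end adjacent to $x$ in $H$. A closed ditrail is a closed directed walk that uses no arc twice (vertices may repeat). The set $S$ is closed-trailable in $D$ if $D$ contains a closed ditrail that passes through all vertices of $S$; and $D$ is $S$-strictly strong if there are two distinct nonadjacent vertices $u,v\in S$ such that $D$ contains a closed ditrail through $u$ and $v$. Suppose that the following holds: if $X=\{x,x'\}$ with $x\neq x'$, and $|M_x|=\frac m2$ or $|M_{x'}|=\frac m2$, then $D$ is $S$-strictly strong. If the minimum semi-degree satisfies $\delta^0(H)\ge m$, i.e. every vertex of $H$ has in-degree at least $m$ and out-degree at least $m$ in $H$, then $S$ is closed-trailable in $D$. -/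

import Mathlib

namespace Digraph

variable {V : Type*}

/-- The subdigraph `D⟨S⟩` induced by a set `S` of vertices. -/
def inducedOn (D : Digraph V) (S : Set V) : Digraph S where
  Adj u v := D.Adj u v

/-- `u` and `v` are adjacent: `(u, v)` or `(v, u)` is an arc. -/
def IsAdjacent (D : Digraph V) (u v : V) : Prop := D.Adj u v ∨ D.Adj v u

/-- The out-neighbourhood of `v`. -/
def outNbhd (D : Digraph V) (v : V) : Set V := {u | u ≠ v ∧ D.Adj v u}

/-- The in-neighbourhood of `v`. -/
def inNbhd (D : Digraph V) (v : V) : Set V := {u | u ≠ v ∧ D.Adj u v}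

/-- The out-degree of `v`. -/
noncomputable def outDeg (D : Digraph V) (v : V) : ℕ := (D.outNbhd v).ncard

/-- The in-degree of `v`. -/
noncomputable def inDeg (D : Digraph V) (v : V) : ℕ := (D.inNbhd v).ncard

/-- The minimum semi-degree `δ⁰(D) = min {δ⁺(D), δ⁻(D)}` (of a finite digraph with at least one
vertex). -/
noncomputable def minSemidegree (D : Digraph V) : ℕ := min (⨅ v, D.outDeg v) (⨅ v, D.inDeg v)

/-- Directed walks from one vertex to another. -/
inductive DiWalk (D : Digraph V) : V → V → Type _
  | nil (u : V) : DiWalk D u u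
  | cons {u v w : V} (h : D.Adj u v) (p : DiWalk D v w) : DiWalk D u w

namespace DiWalk

/-- The list of vertices visited by a directed walk, in order. -/
def support {D : Digraph V} : {u v : V} → D.DiWalk u v → List V
  | _, _, nil u => [u]
  | u, _, cons _ p => u :: p.support

/-- The list of arcs traversed by a directed walk, in order. -/
def arcs {D : Digraph V} : {u v : V} → D.DiWalk u v → List (V × V)
  | _, _, nil _ => []
  | u, _, cons (v := v) _ p => (u, v) :: p.arcs

/-- A ditrail is a directed walk that uses no arc twice. -/
def IsDitrail {D : Digraph V} {u v : V} (p : D.DiWalk u v) : Prop := p.arcs.Nodup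

end DiWalk

/-- `D` contains a closed ditrail through all the vertices of `T`. -/
def HasClosedDitrailThrough (D : Digraph V) (T : Set V) : Prop :=
  ∃ (u : V) (Q : D.DiWalk u u), Q.IsDitrail ∧ ∀ v ∈ T, v ∈ Q.support

/-- `S` is closed-trailable in `D`. -/
def IsClosedTrailable (D : Digraph V) (S : Set V) : Prop := D.HasClosedDitrailThrough S

/-- `D` is `S`-strictly strong: some closed ditrail of `D` passes through two (distinct)
nonadjacent vertices of `S`. -/
def IsStrictlyStrong (D : Digraph V) (S : Set V) : Prop :=
  ∃ u ∈ S, ∃ v ∈ S, u ≠ v ∧ ¬ D.IsAdjacent u v ∧ D.HasClosedDitrailThrough {u, v}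

/-- The underlying graph `UG(D)`. -/
abbrev UG (D : Digraph V) : SimpleGraph V := D.toSimpleGraphInclusive

/-- `M` is a maximum matching of `D`, that is, of its underlying graph. -/
def IsMaximumMatching (D : Digraph V) (M : D.UG.Subgraph) : Prop :=
  M.IsMatching ∧ ∀ M' : D.UG.Subgraph, M'.IsMatching → M'.edgeSet.ncard ≤ M.edgeSet.ncard

/-- `M_x`: the edges of `M` that have an end adjacent to `x` in `D`. -/
def matchingEdgesAt (D : Digraph V) (M : D.UG.Subgraph) (x : V) : Set (Sym2 V) :=
  {e | e ∈ M.edgeSet ∧ ∃ u ∈ e, D.IsAdjacent u x}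

end Digraph

/-! Everything depends on how many vertices X of S the matching misses.

If |X| ≤ 1, then H has at most 2m + 1 vertices and semi-degrees at least m. Ghouila-Houri's theorem,
applied after adding a dominating vertex, gives a Hamiltonian path of H. Its ends are joined
backwards by one arc or, by counting, by two arcs through a common neighbour. These arcs are not on
the path, so a closed ditrail results (`isClosedTrailable_of_natCard_le`).

If X contains x ≠ x', the absence of augmenting paths of length 3 puts N(x') among the covered
vertices whose partner is not in N(x). Both neighbourhoods have at least m of the 2m covered
vertices, so each has exactly m, and semi-degree m forces all their arcs in both directions
(`IsMaxPartner.neighborSet_eq`). Augmenting paths of length 5 then fix the rest of H. Either x and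
x' have a common neighbour and 2-cycles connect all of H, or H consists of two disjoint complete
digraphs around x and x'. The latter is the exceptional case, where the hypothesis supplies a closed
ditrail meeting both parts. A closed ditrail absorbs any new vertex joined to it by a 2-cycle
(`exists_closed_ditrail_saturated`), so in both cases it grows to cover S. -/

namespace Digraph

/-! ### Ghouila-Houri's theorem and Hamiltonian paths. -/

section GhouilaHouri

variable {α : Type*}

/-- `p 0, …, p l` is a path of the relation `A` inside `U`. -/
structure IsPathIn (A : α → α → Prop) (U : Set α) (l : ℕ) (p : ℕ → α) : Prop where
  mem : ∀ t ≤ l, p t ∈ U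
  inj : ∀ s ≤ l, ∀ t ≤ l, p s = p t → s = t
  adj : ∀ t < l, A (p t) (p (t + 1))

/-- `c 0, …, c (k - 1), c k = c 0` is a cycle of the relation `A`. -/
structure IsCyc (A : α → α → Prop) (k : ℕ) (c : ℕ → α) : Prop where
  pos : 0 < k
  closed : c k = c 0
  inj : ∀ s < k, ∀ t < k, c s = c t → s = t
  adj : ∀ t < k, A (c t) (c (t + 1))

theorem le_natCard_of_injOn [Finite α] {k : ℕ} {f : ℕ → α}
    (h : ∀ s < k, ∀ t < k, f s = f t → s = t) : k ≤ Nat.card α := by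
  have := Nat.card_le_card_of_injective (fun i : Fin k => f i)
    (fun i j hij => Fin.ext (h i i.2 j j.2 hij))
  simpa using this

theorem exists_maximal_path [Finite α] (A : α → α → Prop) {U : Set α} (hU : U.Nonempty) :
    ∃ l p, IsPathIn A U l p ∧ (∀ v ∈ U, A v (p 0) → ∃ t ≤ l, p t = v) ∧
      (∀ v ∈ U, A (p l) v → ∃ t ≤ l, p t = v) := by
  by_contra! hcon
  have key : ∀ l, ∃ p, IsPathIn A U l p := by
    intro l
    induction l with
    | zero =>
      obtain ⟨u, hu⟩ := hU
      exact ⟨fun _ => u, fun _ _ => hu, fun _ _ _ _ _ => by omega, fun _ _ => by omega⟩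
    | succ l ih =>
      obtain ⟨p, hp⟩ := ih
      by_cases h : ∀ v ∈ U, A v (p 0) → ∃ t ≤ l, p t = v
      · obtain ⟨v, hv, hA, hne⟩ := hcon l p hp h
        refine ⟨fun t => if t ≤ l then p t else v, ?_, ?_, ?_⟩
        · intro t _
          split_ifs with h1
          · exact hp.mem t h1
          · exact hv
        · intro s hs t ht
          split_ifs with h1 h2 h2
          · exact hp.inj s h1 t h2
          · exact fun h => absurd h (hne s h1)
          · exact fun h => absurd h.symm (hne t h2)
          · omega
        · intro t ht
          rw [if_pos (by omega)]
          split_ifs with h1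
          · exact hp.adj t (by omega)
          · obtain rfl : t = l := by omega
            exact hA
      · push Not at h
        obtain ⟨v, hv, hA, hne⟩ := h
        refine ⟨fun t => if t = 0 then v else p (t - 1), ?_, ?_, ?_⟩
        · intro t ht
          split_ifs with h1
          · exact hv
          · exact hp.mem _ (by omega)
        · intro s hs t ht
          split_ifs with h1 h2 h2
          · omega
          · exact fun h => absurd h.symm (hne _ (by omega))
          · exact fun h => absurd h (hne _ (by omega))
          · intro h
            have := hp.inj _ (by omega) _ (by omega) h
            omega
        · intro t ht
          rw [if_neg (show t + 1 ≠ 0 by omega)]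
          split_ifs with h1
          · subst h1
            exact hA
          · have := hp.adj (t - 1) (by omega)
            rwa [show t - 1 + 1 = t + 1 - 1 by omega] at this
  obtain ⟨p, hp⟩ := key (Nat.card α)
  have := le_natCard_of_injOn (k := Nat.card α + 1) (f := p)
    (fun s hs t ht => hp.inj s (by omega) t (by omega))
  omega

theorem IsCyc.rotate {A : α → α → Prop} {k : ℕ} {c : ℕ → α} (hc : IsCyc A k c) {s : ℕ}
    (hs : s < k) : IsCyc A k (fun t => if t + s < k then c (t + s) else c (t + s - k)) := by
  refine ⟨hc.pos, ?_, ?_, ?_⟩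
  · rw [if_neg (by omega), if_pos (by omega)]
    congr 1
    omega
  · intro t ht t' ht'
    split_ifs with h1 h2 h2 <;> intro h <;> have := hc.inj _ (by omega) _ (by omega) h <;> omega
  · intro t ht
    split_ifs with h1 h2 h2
    · rw [show t + 1 + s = t + s + 1 by omega]
      exact hc.adj _ h1
    · rw [show t + 1 + s - k = 0 by omega, ← hc.closed]
      have := hc.adj _ h1
      rwa [show t + s + 1 = k by omega] at this
    · omega
    · rw [show t + 1 + s - k = t + s - k + 1 by omega]
      exact hc.adj _ (by omega)

theorem IsCyc.exists_rotate {A : α → α → Prop} {k : ℕ} {c : ℕ → α} (hc : IsCyc A k c) {s : ℕ}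
    (hs : s < k) :
    ∃ e, IsCyc A k e ∧ e 0 = c s ∧ ∀ v, (∀ t < k, e t ≠ v) ↔ ∀ t < k, c t ≠ v := by
  refine ⟨_, hc.rotate hs, by simp [hs], fun v => ⟨fun h t ht => ?_, fun h t ht => ?_⟩⟩
  · by_cases hts : s ≤ t
    · have := h (t - s) (by omega)
      rwa [if_pos (by omega), show t - s + s = t by omega] at this
    · have := h (t + k - s) (by omega)
      rwa [if_neg (by omega), show t + k - s + s - k = t by omega] at this
  · split_ifs with h1
    · exact h _ h1
    · exact h _ (by omega)

/-- Replacing the section of a cycle strictly between `c i` and `c j` by a path. -/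
theorem IsCyc.splice {A : α → α → Prop} {k l : ℕ} {c p : ℕ → α} (hc : IsCyc A k c)
    (hp : IsPathIn A {v | ∀ t < k, c t ≠ v} l p) {i j : ℕ} (hij : i < j) (hj : j ≤ k)
    (hi : A (c i) (p 0)) (hjl : A (p l) (c j)) :
    ∃ c', IsCyc A (k + l + 2 + i - j) c' := by
  -- The new cycle runs through c 0, …, c i, then p 0, …, p l, then c j, …, c k.
  refine ⟨fun t => if t ≤ i then c t else if t ≤ i + l + 1 then p (t - (i + 1))
    else c (t + j - (i + l + 2)), by omega, ?_, ?_, ?_⟩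
  · rw [if_neg (by omega), if_neg (by omega), if_pos (by omega), ← hc.closed]
    congr 1
    omega
  · intro s hs t ht
    split_ifs with h1 h2 h3 h3 h4 h5 h5 h6 <;> intro h
    all_goals first
      | (have := hc.inj _ (by omega) _ (by omega) h; omega)
      | (have := hp.inj _ (by omega) _ (by omega) h; omega)
      | exact absurd h (hp.mem _ (by omega) _ (by omega))
      | exact absurd h.symm (hp.mem _ (by omega) _ (by omega))
  · intro t ht
    rcases lt_trichotomy t i with h | rfl | h
    · rw [if_pos h.le, if_pos (by omega)]
      exact hc.adj t (by omega)
    · rw [if_pos le_rfl, if_neg (by omega), if_pos (by omega)]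
      simpa using hi
    · rw [if_neg (by omega), if_neg (show ¬ t + 1 ≤ i by omega)]
      rcases lt_trichotomy t (i + l + 1) with h' | rfl | h'
      · rw [if_pos h'.le, if_pos (by omega)]
        have := hp.adj (t - (i + 1)) (by omega)
        rwa [show t - (i + 1) + 1 = t + 1 - (i + 1) by omega] at this
      · rw [if_pos le_rfl, if_neg (by omega)]
        rw [show i + l + 1 - (i + 1) = l by omega,
          show i + l + 1 + 1 + j - (i + l + 2) = j by omega]
        exact hjl
      · rw [if_neg (by omega), if_neg (by omega)]
        rw [show t + 1 + j - (i + l + 2) = t + j - (i + l + 2) + 1 by omega]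
        exact hc.adj _ (by omega)

theorem IsCyc.card_add_le [Finite α] {A : α → α → Prop} {k l : ℕ} {c p : ℕ → α}
    (hc : IsCyc A k c) (hp : IsPathIn A {v | ∀ t < k, c t ≠ v} l p) :
    k + l + 1 ≤ Nat.card α := by
  refine le_natCard_of_injOn (f := fun t => if t < k then c t else p (t - k)) ?_
  intro s hs t ht
  split_ifs with h1 h2 h2 <;> intro h
  · exact hc.inj _ h1 _ h2 h
  · exact absurd h (hp.mem _ (by omega) _ h1)
  · exact absurd h.symm (hp.mem _ (by omega) _ h2)
  · have := hp.inj _ (by omega) _ (by omega) h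
    omega

open Classical in
/-- If all neighbours (for `B`) of an end `p e` of a path lie on the path or on the cycle, many of
them lie on the cycle. -/
theorem le_card_filter_add {B : α → Prop} {k l e d : ℕ} {c p : ℕ → α} (he : e ≤ l)
    (hB : ∀ v, (∀ t < k, c t ≠ v) → B v → ∃ t ≤ l, p t = v)
    (hd : d ≤ {u | u ≠ p e ∧ B u}.ncard) :
    d ≤ ((Finset.range k).filter (fun t => B (c t))).card + l := by
  -- Since `p e` itself is excluded, the path accounts for at most `l` neighbours, not `l + 1`.
  have hsub : {u | u ≠ p e ∧ B u} ⊆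
      ((((Finset.range k).filter (fun t => B (c t))).image c ∪
        ((Finset.range (l + 1)).erase e).image p : Finset α) : Set α) := by
    rintro u ⟨hu, hBu⟩
    simp only [Finset.coe_union, Finset.coe_image, Set.mem_union, Set.mem_image, Finset.mem_coe,
      Finset.mem_filter, Finset.mem_range, Finset.mem_erase]
    by_cases h : ∀ t < k, c t ≠ u
    · obtain ⟨t, ht, rfl⟩ := hB u h hBu
      exact Or.inr ⟨t, ⟨fun h => hu (by rw [h]), by omega⟩, rfl⟩
    · push Not at h
      obtain ⟨t, ht, rfl⟩ := h
      exact Or.inl ⟨t, ⟨ht, hBu⟩, rfl⟩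
  have h1 := Set.ncard_le_ncard hsub (Finset.finite_toSet _)
  rw [Set.ncard_coe_finset] at h1
  have h2 := Finset.card_union_le (((Finset.range k).filter (fun t => B (c t))).image c)
    (((Finset.range (l + 1)).erase e).image p)
  have h3 := Finset.card_image_le (s := (Finset.range k).filter (fun t => B (c t))) (f := c)
  have h4 := Finset.card_image_le (s := (Finset.range (l + 1)).erase e) (f := p)
  rw [Finset.card_erase_of_mem (by simp; omega), Finset.card_range] at h4
  omega

/-- Let S and T be the positions on the cycle of the in-neighbours of `p 0` and the out-neighbours
of `p l`. If no splice lengthens the cycle, an element i of S excludes i + 1, …, i + l + 1 from T.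
Hence S + 1, a block of l positions after max S + 1, and T are disjoint, so (d - l) + l + (d - l) ≤
k, against k + l + 1 ≤ 2d. -/
theorem IsCyc.exists_longer_of_adj_zero [Finite α] {A : α → α → Prop} {d k l : ℕ} {c p : ℕ → α}
    (hn : Nat.card α ≤ 2 * d) (hout : ∀ v, d ≤ {u | u ≠ v ∧ A v u}.ncard)
    (hin : ∀ v, d ≤ {u | u ≠ v ∧ A u v}.ncard) (hc : IsCyc A k c) (hk : d + 1 ≤ k)
    (hp : IsPathIn A {v | ∀ t < k, c t ≠ v} l p)
    (hp0 : ∀ v, (∀ t < k, c t ≠ v) → A v (p 0) → ∃ t ≤ l, p t = v)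
    (hpl : ∀ v, (∀ t < k, c t ≠ v) → A (p l) v → ∃ t ≤ l, p t = v) (h0 : A (p l) (c 0)) :
    ∃ k' > k, ∃ c', IsCyc A k' c' := by
  classical
  by_contra! hcon
  have gap : ∀ i j, i < j → j ≤ k → A (c i) (p 0) → A (p l) (c j) → i + l + 2 ≤ j := by
    intro i j hij hj hi hjl
    by_contra hlt
    obtain ⟨c', hc'⟩ := hc.splice hp hij hj hi hjl
    exact hcon _ (by omega) c' hc'
  have hcard := hc.card_add_le hp
  have hS := le_card_filter_add (Nat.zero_le l) hp0 (hin (p 0))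
  have hT := le_card_filter_add le_rfl hpl (hout (p l))
  set S := (Finset.range k).filter (fun t => A (c t) (p 0)) with hSdef
  set T := (Finset.range k).filter (fun t => A (p l) (c t)) with hTdef
  have hSne : S.Nonempty := Finset.card_pos.mp (by omega)
  obtain ⟨hi0k, hi0⟩ := Finset.mem_filter.mp (S.max'_mem hSne)
  set i0 := S.max' hSne with hi0def
  have hmax : ∀ i ∈ S, i ≤ i0 := fun i hi => S.le_max' i hi
  -- Position 0 is in T and recurs as position `k`, so the block after `i0` ends before the cycle
  -- closes.
  have hlast := gap i0 k (Finset.mem_range.mp hi0k) le_rfl hi0 (by rw [hc.closed]; exact h0)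
  have hd1 : Disjoint (S.image (· + 1)) (Finset.Ico (i0 + 2) (i0 + l + 2)) := by
    rw [Finset.disjoint_left]
    intro t ht ht'
    obtain ⟨i, hi, rfl⟩ := Finset.mem_image.mp ht
    have := hmax i hi
    have := Finset.mem_Ico.mp ht'
    omega
  have hd2 : Disjoint (S.image (· + 1) ∪ Finset.Ico (i0 + 2) (i0 + l + 2)) T := by
    rw [Finset.disjoint_left]
    intro t ht ht'
    obtain ⟨htk, htT⟩ := Finset.mem_filter.mp ht'
    have htk := Finset.mem_range.mp htk
    rcases Finset.mem_union.mp ht with h | h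
    · obtain ⟨i, hi, rfl⟩ := Finset.mem_image.mp h
      have := gap i (i + 1) (by omega) htk.le (Finset.mem_filter.mp hi).2 htT
      omega
    · have h := Finset.mem_Ico.mp h
      have := gap i0 t (by omega) htk.le hi0 htT
      omega
  have hsub : (S.image (· + 1) ∪ Finset.Ico (i0 + 2) (i0 + l + 2)) ∪ T ⊆ Finset.range k := by
    intro t ht
    rw [Finset.mem_range]
    rcases Finset.mem_union.mp ht with h | h
    · rcases Finset.mem_union.mp h with h | h
      · obtain ⟨i, hi, rfl⟩ := Finset.mem_image.mp h
        have := hmax i hi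
        omega
      · have := Finset.mem_Ico.mp h
        omega
    · exact Finset.mem_range.mp (Finset.mem_filter.mp h).1
  have hle := Finset.card_le_card hsub
  rw [Finset.card_union_of_disjoint hd2, Finset.card_union_of_disjoint hd1,
    Finset.card_image_of_injective _ (add_left_injective 1), Nat.card_Ico, Finset.card_range] at hle
  omega

theorem IsCyc.exists_longer [Finite α] {A : α → α → Prop} {d k : ℕ} {c : ℕ → α}
    (hn : Nat.card α ≤ 2 * d) (hout : ∀ v, d ≤ {u | u ≠ v ∧ A v u}.ncard)
    (hin : ∀ v, d ≤ {u | u ≠ v ∧ A u v}.ncard) (hc : IsCyc A k c) (hk : d + 1 ≤ k)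
    (hne : ∃ v, ∀ t < k, c t ≠ v) : ∃ k' > k, ∃ c', IsCyc A k' c' := by
  classical
  obtain ⟨l, p, hp, hp0, hpl⟩ := exists_maximal_path A (U := {v | ∀ t < k, c t ≠ v}) hne
  have hcard := hc.card_add_le hp
  have hT := le_card_filter_add le_rfl hpl (hout (p l))
  obtain ⟨s, hs⟩ : ((Finset.range k).filter (fun t => A (p l) (c t))).Nonempty :=
    Finset.card_pos.mp (by omega)
  obtain ⟨hsk, hsA⟩ := Finset.mem_filter.mp hs
  have hsk := Finset.mem_range.mp hsk
  obtain ⟨e, he, he0, hset⟩ := hc.exists_rotate hsk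
  refine he.exists_longer_of_adj_zero hn hout hin hk (l := l) (p := p) ?_ ?_ ?_ ?_
  · simpa only [hset] using hp
  · simpa only [hset] using! hp0
  · simpa only [hset] using! hpl
  · rw [he0]
    exact hsA

/-- All out-neighbours of the last vertex of a maximal path lie on it; returning to the earliest one
encloses at least `d` vertices besides the last. -/
theorem exists_isCyc_of_minDegree [Finite α] [Nonempty α] {A : α → α → Prop} {d : ℕ} (hd : 0 < d)
    (hout : ∀ v, d ≤ {u | u ≠ v ∧ A v u}.ncard) : ∃ k ≥ d + 1, ∃ c, IsCyc A k c := by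
  classical
  obtain ⟨l, p, hp, -, hpl⟩ := exists_maximal_path A (U := (Set.univ : Set α)) Set.univ_nonempty
  set T := (Finset.range l).filter (fun t => A (p l) (p t)) with hT
  have hsub : {u | u ≠ p l ∧ A (p l) u} ⊆ ((T.image p : Finset α) : Set α) := by
    rintro u ⟨hu, hA⟩
    obtain ⟨t, ht, rfl⟩ := hpl u trivial hA
    have : t ≠ l := fun h => hu (by rw [h])
    simp only [Finset.coe_image, Set.mem_image, Finset.mem_coe]
    exact ⟨t, Finset.mem_filter.mpr ⟨Finset.mem_range.mpr (by omega), hA⟩, rfl⟩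
  have h1 := Set.ncard_le_ncard hsub (Finset.finite_toSet _)
  rw [Set.ncard_coe_finset] at h1
  have h2 := Finset.card_image_le (s := T) (f := p)
  have h3 := hout (p l)
  have hTne : T.Nonempty := Finset.card_pos.mp (by omega)
  obtain ⟨hil, hiA⟩ := Finset.mem_filter.mp (T.min'_mem hTne)
  set i := T.min' hTne with hi
  have hil := Finset.mem_range.mp hil
  have h4 : T ⊆ Finset.Ico i l := fun t ht => Finset.mem_Ico.mpr
    ⟨T.min'_le t ht, Finset.mem_range.mp (Finset.mem_filter.mp ht).1⟩
  have h5 := Finset.card_le_card h4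
  rw [Nat.card_Ico] at h5
  refine ⟨l - i + 1, by omega, fun t => if t ≤ l - i then p (t + i) else p i, by omega, ?_, ?_, ?_⟩
  · simp
  · intro s hs t ht
    rw [if_pos (by omega), if_pos (by omega)]
    intro h
    have := hp.inj _ (by omega) _ (by omega) h
    omega
  · intro t ht
    rw [if_pos (by omega)]
    split_ifs with h
    · rw [show t + 1 + i = t + i + 1 by omega]
      exact hp.adj _ (by omega)
    · rw [show t + i = l by omega]
      exact hiA

/-- The theorem of Ghouila-Houri: a digraph on at most `2 * d` vertices with minimum semi-degree
at least `d` has a Hamiltonian cycle. -/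
theorem exists_hamiltonian_isCyc [Finite α] [Nonempty α] {A : α → α → Prop} {d : ℕ} (hd : 0 < d)
    (hn : Nat.card α ≤ 2 * d) (hout : ∀ v, d ≤ {u | u ≠ v ∧ A v u}.ncard)
    (hin : ∀ v, d ≤ {u | u ≠ v ∧ A u v}.ncard) :
    ∃ k c, IsCyc A k c ∧ ∀ v, ∃ t < k, c t = v := by
  by_contra! hcon
  have key : ∀ j, ∃ k, d + 1 + j ≤ k ∧ ∃ c, IsCyc A k c := by
    intro j
    induction j with
    | zero => exact exists_isCyc_of_minDegree hd hout
    | succ j ih =>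
      obtain ⟨k, hk, c, hc⟩ := ih
      obtain ⟨k', hk', h⟩ := hc.exists_longer hn hout hin (by omega) (hcon k c hc)
      exact ⟨k', by omega, h⟩
  obtain ⟨k, hk, c, hc⟩ := key (Nat.card α)
  have := le_natCard_of_injOn hc.inj
  omega

/-- The relation on `Option α` obtained from `A` by adding a vertex joined to and from every other
vertex. -/
def AddDominating (A : α → α → Prop) : Option α → Option α → Prop
  | none, none => False
  | none, some _ => True
  | some _, none => True
  | some a, some b => A a b

theorem ncard_option_le [Finite α] {s : Set α} {T : Set (Option α)} {d : ℕ} (hs : d ≤ s.ncard)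
    (hnone : none ∈ T) (hsome : ∀ a ∈ s, some a ∈ T) : d + 1 ≤ T.ncard := by
  have h1 : insert none (some '' s) ⊆ T := by
    rintro u (rfl | ⟨a, ha, rfl⟩)
    · exact hnone
    · exact hsome a ha
  have h2 := Set.ncard_le_ncard h1 (Set.toFinite T)
  rw [Set.ncard_insert_of_notMem (by simp), Set.ncard_image_of_injective _ (Option.some_injective α)]
    at h2
  omega

/-- A digraph on at most `2 * d + 1` vertices with minimum semi-degree at least `d` has a
Hamiltonian path. -/
theorem exists_hamiltonian_path [Finite α] [Nonempty α] {A : α → α → Prop} {d : ℕ}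
    (hn : Nat.card α ≤ 2 * d + 1) (hout : ∀ v, d ≤ {u | u ≠ v ∧ A v u}.ncard)
    (hin : ∀ v, d ≤ {u | u ≠ v ∧ A u v}.ncard) :
    ∃ l p, IsPathIn A Set.univ l p ∧ ∀ v, ∃ t ≤ l, p t = v := by
  have hα := Nat.card_pos (α := α)
  -- The added vertex has semi-degrees |α| ≥ d + 1, since an out-neighbourhood omits its own vertex.
  have hfull : ∀ T : Set (Option α), (∀ a : α, some a ∈ T) → d + 1 ≤ T.ncard := by
    intro T hT
    have h1 : some '' (Set.univ : Set α) ⊆ T := by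
      rintro _ ⟨a, -, rfl⟩
      exact hT a
    have h2 := Set.ncard_le_ncard h1 (Set.toFinite T)
    rw [Set.ncard_image_of_injective _ (Option.some_injective α), Set.ncard_univ] at h2
    obtain ⟨v⟩ := ‹Nonempty α›
    have h3 : ({u | u ≠ v ∧ A v u}).ncard < (Set.univ : Set α).ncard :=
      Set.ncard_lt_ncard ⟨Set.subset_univ _, fun h => (h (Set.mem_univ v)).1 rfl⟩
    rw [Set.ncard_univ] at h3
    have := hout v
    omega
  obtain ⟨k, c, hc, hcov⟩ := exists_hamiltonian_isCyc (A := AddDominating A) (d := d + 1)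
    (by omega) (by rw [Finite.card_option]; omega)
    (by
      rintro (_ | v)
      · exact hfull _ fun a => ⟨by simp, trivial⟩
      · exact ncard_option_le (hout v) ⟨by simp, trivial⟩ fun a ha => ⟨by simpa using ha.1, ha.2⟩)
    (by
      rintro (_ | v)
      · exact hfull _ fun a => ⟨by simp, trivial⟩
      · exact ncard_option_le (hin v) ⟨by simp, trivial⟩ fun a ha => ⟨by simpa using ha.1, ha.2⟩)
  obtain ⟨s, hs, hcs⟩ := hcov none
  obtain ⟨e, he, he0, hset⟩ := hc.exists_rotate hs
  have hecov : ∀ v, ∃ t < k, e t = v := by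
    intro v
    by_contra! h
    obtain ⟨t, ht, htv⟩ := hcov v
    exact (hset v).mp h t ht htv
  -- With `none` rotated to position 0, the rest of the cycle is the path, shifted by one; values
  -- past its end are arbitrary.
  have hsome : ∀ t, ∃ a, t + 1 < k → e (t + 1) = some a := by
    intro t
    by_cases ht : t + 1 < k
    · have hne : e (t + 1) ≠ none := fun h => by
        have := he.inj _ ht _ he.pos (by rw [h, he0, hcs])
        omega
      obtain ⟨a, ha⟩ := Option.ne_none_iff_exists'.mp hne
      exact ⟨a, fun _ => ha⟩
    · exact ⟨Classical.arbitrary α, fun h => absurd h ht⟩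
  choose p hp using hsome
  have hpcov : ∀ v, ∃ t, t + 1 < k ∧ p t = v := by
    intro v
    obtain ⟨t, ht, htv⟩ := hecov (some v)
    obtain _ | t := t
    · rw [he0, hcs] at htv
      cases htv
    · exact ⟨t, ht, Option.some_injective _ ((hp t ht).symm.trans htv)⟩
  obtain ⟨t₀, ht₀, -⟩ := hpcov (Classical.arbitrary α)
  refine ⟨k - 2, p, ⟨fun _ _ => trivial, fun s hs t ht h => ?_, fun t ht => ?_⟩, fun v => ?_⟩
  · have := he.inj (s + 1) (by omega) (t + 1) (by omega)
      (by rw [hp s (by omega), hp t (by omega), h])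
    omega
  · have := he.adj (t + 1) (by omega)
    rwa [hp t (by omega), hp (t + 1) (by omega)] at this
  · obtain ⟨t, ht, h⟩ := hpcov v
    exact ⟨t, by omega, h⟩

end GhouilaHouri

end Digraph

namespace Digraph

variable {V : Type*}

/-! ### Extending and closing ditrails. -/

section Walks

variable {D : Digraph V}

theorem DiWalk.mem_support_of_mem_arcs {u v : V} (p : D.DiWalk u v) {a b : V}
    (h : (a, b) ∈ p.arcs) : a ∈ p.support ∧ b ∈ p.support := by
  induction p with
  | nil u => simp [DiWalk.arcs] at h
  | @cons u v w huv p ih =>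
    have hv : v ∈ p.support := by cases p <;> simp [DiWalk.support]
    simp only [DiWalk.arcs, List.mem_cons, Prod.mk.injEq] at h
    simp only [DiWalk.support, List.mem_cons]
    rcases h with ⟨rfl, rfl⟩ | h
    · exact ⟨Or.inl rfl, Or.inr hv⟩
    · exact ⟨Or.inr (ih h).1, Or.inr (ih h).2⟩

/-- Inserting the `2`-cycle `w, v, w` into a walk through `w`. -/
theorem DiWalk.exists_insert {u z : V} (p : D.DiWalk u z) {w v : V} (hw : w ∈ p.support)
    (hwv : D.Adj w v) (hvw : D.Adj v w) :
    ∃ q : D.DiWalk u z, q.arcs.Perm ((w, v) :: (v, w) :: p.arcs) ∧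
      ∀ y, y ∈ q.support ↔ y = v ∨ y ∈ p.support := by
  induction p with
  | nil u =>
    obtain rfl : w = u := by simpa [DiWalk.support] using hw
    exact ⟨.cons hwv (.cons hvw (.nil _)), by simp [DiWalk.arcs], fun y => by
      simp [DiWalk.support]; tauto⟩
  | @cons u b z hub p ih =>
    by_cases h : w = u
    · subst h
      exact ⟨.cons hwv (.cons hvw (.cons hub p)), by simp [DiWalk.arcs], fun y => by
        simp [DiWalk.support]; tauto⟩
    · have hw' : w ∈ p.support := by simpa [DiWalk.support, h] using hw
      obtain ⟨q, hq, hs⟩ := ih hw'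
      refine ⟨.cons hub q, ?_, fun y => ?_⟩
      · simp only [DiWalk.arcs]
        exact (hq.cons _).trans ((List.Perm.swap _ _ _).trans ((List.Perm.swap _ _ _).cons _))
      · simp only [DiWalk.support, List.mem_cons, hs]
        tauto

theorem DiWalk.exists_concat {u v w : V} (p : D.DiWalk u v) (h : D.Adj v w) :
    ∃ q : D.DiWalk u w, q.arcs = p.arcs ++ [(v, w)] ∧ q.support = p.support ++ [w] := by
  induction p with
  | nil u => exact ⟨.cons h (.nil _), rfl, rfl⟩
  | cons huv p ih =>
    obtain ⟨q, h1, h2⟩ := ih h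
    exact ⟨.cons huv q, by simp [DiWalk.arcs, h1], by simp [DiWalk.support, h2]⟩

theorem exists_diWalk_of_seq (p : ℕ → V) (l : ℕ) (hp : ∀ t < l, D.Adj (p t) (p (t + 1))) :
    ∃ q : D.DiWalk (p 0) (p l), q.arcs = (List.range l).map (fun t => (p t, p (t + 1))) ∧
      ∀ t ≤ l, p t ∈ q.support := by
  induction l with
  | zero => exact ⟨.nil _, rfl, fun t ht => by
      obtain rfl : t = 0 := by omega
      simp [DiWalk.support]⟩
  | succ l ih =>
    obtain ⟨q, h1, h2⟩ := ih fun t ht => hp t (by omega)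
    obtain ⟨q', h1', h2'⟩ := q.exists_concat (hp l (by omega))
    refine ⟨q', by rw [h1', h1, List.range_succ, List.map_append]; rfl, fun t ht => ?_⟩
    rw [h2', List.mem_append]
    rcases Nat.lt_or_ge l t with h | h
    · obtain rfl : t = l + 1 := by omega
      simp
    · exact Or.inl (h2 t h)

/-- Every closed ditrail extends to one whose set of vertices is closed under adjacency by arcs in
both directions. -/
theorem exists_closed_ditrail_saturated [Finite V] (hD : ∀ v, ¬ D.Adj v v) {u : V}
    (Q : D.DiWalk u u) (hQ : Q.IsDitrail) :
    ∃ Q' : D.DiWalk u u, Q'.IsDitrail ∧ (∀ y ∈ Q.support, y ∈ Q'.support) ∧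
      ∀ w ∈ Q'.support, ∀ v, D.Adj w v → D.Adj v w → v ∈ Q'.support := by
  -- The vertex set, not the length, is maximised; it ranges over a finite type.
  let P : Set V → Prop := fun s => ∃ Q' : D.DiWalk u u, Q'.IsDitrail ∧
    (∀ y ∈ Q.support, y ∈ Q'.support) ∧ {y | y ∈ Q'.support} = s
  obtain ⟨s, -, ⟨Q', hQ', hsup, rfl⟩, hmax⟩ :=
    Set.Finite.exists_le_maximal (s := {s | P s}) (Set.toFinite _)
      (a := {y | y ∈ Q.support}) ⟨Q, hQ, fun _ h => h, rfl⟩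
  refine ⟨Q', hQ', hsup, fun w hw v hwv hvw => ?_⟩
  by_contra hv
  obtain ⟨q, hq, hs⟩ := Q'.exists_insert hw hwv hvw
  refine hv (hmax (y := {y | y ∈ q.support}) ⟨q, ?_, fun y hy => (hs y).mpr (Or.inr (hsup y hy)), rfl⟩
    (fun y hy => (hs y).mpr (Or.inr hy)) ((hs v).mpr (Or.inl rfl)))
  -- Both inserted arcs end or start at `v`, which was not on the trail; they differ because there
  -- are no loops.
  rw [DiWalk.IsDitrail, hq.nodup_iff, List.nodup_cons, List.nodup_cons, List.mem_cons]
  refine ⟨?_, fun h => hv (Q'.mem_support_of_mem_arcs h).1, hQ'⟩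
  rintro (h | h)
  · rw [Prod.mk.injEq] at h
    rw [h.1] at hwv
    exact hD _ hwv
  · exact hv (Q'.mem_support_of_mem_arcs h).2

/-- If the induced subdigraph on `S` has at most `2 * d + 1` vertices and minimum semi-degree at
least `d`, then `S` is closed-trailable. -/
theorem isClosedTrailable_of_natCard_le [Finite V] (hD : ∀ v, ¬ D.Adj v v) {S : Set V}
    [Nonempty S] {d : ℕ} (hd : 0 < d) (hn : Nat.card S ≤ 2 * d + 1)
    (hout : ∀ v, d ≤ (D.inducedOn S).outDeg v) (hin : ∀ v, d ≤ (D.inducedOn S).inDeg v) :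
    D.IsClosedTrailable S := by
  obtain ⟨l, p, hp, hcov⟩ := exists_hamiltonian_path hn hout hin
  obtain ⟨q, harcs, hsup⟩ := exists_diWalk_of_seq (D := D) (fun t => (p t : V)) l hp.adj
  have hsupS : ∀ v ∈ S, v ∈ q.support := by
    intro v hv
    obtain ⟨t, ht, h⟩ := hcov ⟨v, hv⟩
    have := hsup t ht
    rwa [h] at this
  have hfst : ∀ b, ((p l : V), b) ∉ q.arcs := by
    intro b hb
    rw [harcs, List.mem_map] at hb
    obtain ⟨t, ht, h⟩ := hb
    have := hp.inj t (List.mem_range.mp ht).le l le_rfl (Subtype.ext (congrArg Prod.fst h))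
    have := List.mem_range.mp ht
    omega
  have hsnd : ∀ a, (a, (p 0 : V)) ∉ q.arcs := by
    intro a ha
    rw [harcs, List.mem_map] at ha
    obtain ⟨t, ht, h⟩ := ha
    have := hp.inj (t + 1) (List.mem_range.mp ht) 0 (by omega)
      (Subtype.ext (congrArg Prod.snd h))
    omega
  have hnodup : q.arcs.Nodup := by
    rw [harcs]
    refine List.Nodup.map_on (fun s hs t ht h => ?_) List.nodup_range
    exact hp.inj s (List.mem_range.mp hs).le t (List.mem_range.mp ht).le
      (Subtype.ext (congrArg Prod.fst h))
  by_cases h0 : D.Adj (p l) (p 0)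
  · obtain ⟨q', h1, h2⟩ := q.exists_concat h0
    refine ⟨_, q', ?_, fun v hv => by rw [h2]; exact List.mem_append_left _ (hsupS v hv)⟩
    rw [DiWalk.IsDitrail, h1, ← List.concat_eq_append]
    exact hnodup.concat (hfst _)
  -- Without such `w`, two disjoint sets of size at least `d` would both avoid the two ends, leaving
  -- only 2d - 1 places.
  · obtain ⟨w, hw1, hw2⟩ : ∃ w : S, D.Adj (p l) w ∧ D.Adj w (p 0) := by
      by_contra! hcon
      have hdisj : Disjoint ((D.inducedOn S).outNbhd (p l)) ((D.inducedOn S).inNbhd (p 0)) := by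
        rw [Set.disjoint_left]
        exact fun w h1 h2 => hcon w h1.2 h2.2
      have hsub : (D.inducedOn S).outNbhd (p l) ∪ (D.inducedOn S).inNbhd (p 0) ⊆
          {p l, p 0}ᶜ := by
        rintro w (h | h) (rfl | rfl)
        · exact h.1 rfl
        · exact h0 h.2
        · exact h0 h.2
        · exact h.1 rfl
      have h1 := Set.ncard_le_ncard hsub
      rw [Set.ncard_union_eq hdisj] at h1
      have h2 := hout (p l)
      have h3 := hin (p 0)
      rw [outDeg] at h2
      rw [inDeg] at h3
      have h4 := Set.ncard_add_ncard_compl ({p l, p 0} : Set S)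
      by_cases hne : p l = p 0
      · have := hp.inj _ le_rfl 0 (by omega) hne
        subst this
        have hone : ∀ v : S, v = p 0 := fun v => by
          obtain ⟨t, ht, rfl⟩ := hcov v
          obtain rfl : t = 0 := by omega
          rfl
        obtain ⟨v, hv⟩ := (Set.ncard_pos (Set.toFinite _)).mp (hd.trans_le h2)
        exact hv.1 (hone v)
      · rw [Set.ncard_pair hne] at h4
        omega
    obtain ⟨q₁, h1, h2⟩ := q.exists_concat hw1
    obtain ⟨q₂, h3, h4⟩ := q₁.exists_concat hw2
    refine ⟨_, q₂, ?_, fun v hv => by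
      rw [h4, h2]
      exact List.mem_append_left _ (List.mem_append_left _ (hsupS v hv))⟩
    rw [DiWalk.IsDitrail, h3, h1, ← List.concat_eq_append, ← List.concat_eq_append]
    refine (hnodup.concat (hfst _)).concat fun h => ?_
    rw [List.concat_eq_append, List.mem_append, List.mem_singleton, Prod.mk.injEq] at h
    rcases h with h | h
    · exact hsnd _ h
    · rw [← h.2] at hw2
      exact hD _ hw2

end Walks

end Digraph

namespace Digraph

/-! ### Matchings as involutions, and augmenting paths. -/

section Matchings

variable {α : Type*} {G : SimpleGraph α}

theorem two_mul_ncard_eq_of_isMatching [Finite α] {M : G.Subgraph} (hM : M.IsMatching)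
    {E : Set (Sym2 α)} (hE : E ⊆ M.edgeSet) : 2 * E.ncard = {v | ∃ e ∈ E, v ∈ e}.ncard := by
  induction E, Set.toFinite E using Set.Finite.induction_on with
  | empty => simp
  | @insert e E he _ ih =>
    rw [Set.ncard_insert_of_notMem he, mul_add, ih ((Set.subset_insert _ _).trans hE)]
    have heM := hE (Set.mem_insert e E)
    induction e with
    | h a b =>
      have hab : M.Adj a b := heM
      have hset : {v | ∃ e ∈ insert s(a, b) E, v ∈ e} = {v | ∃ e ∈ E, v ∈ e} ∪ {a, b} := by
        ext v
        simp only [Set.mem_insert_iff, Set.mem_ofPred_eq, exists_eq_or_imp, Sym2.mem_iff,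
          Set.mem_union, Set.mem_singleton_iff]
        exact or_comm
      rw [hset, Set.ncard_union_eq, Set.ncard_pair hab.ne]
      rw [Set.disjoint_left]
      rintro v ⟨f, hf, hvf⟩ hv
      obtain ⟨w, rfl⟩ := hvf
      have hvw : M.Adj v w := hE (Set.mem_insert_of_mem _ hf)
      apply he
      rcases hv with rfl | rfl
      · rwa [hM.eq_of_adj_left hab hvw]
      · rwa [Sym2.eq_swap, hM.eq_of_adj_left hab.symm hvw]

theorem verts_eq_of_isMatching {M : G.Subgraph} (hM : M.IsMatching) :
    {v | ∃ e ∈ M.edgeSet, v ∈ e} = M.verts := by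
  ext v
  constructor
  · rintro ⟨e, he, w, rfl⟩
    exact M.edge_vert he
  · intro hv
    obtain ⟨w, hw, -⟩ := hM hv
    exact ⟨s(v, w), hw, Sym2.mem_mk_left v w⟩

/-- Augmenting a matching thus becomes redefining an involution at a few points; its fixed points
are the missed vertices. -/
theorem exists_partner {M : G.Subgraph} (hM : M.IsMatching) :
    ∃ σ : α → α, σ.Involutive ∧ (∀ v ∈ M.verts, M.Adj v (σ v)) ∧ ∀ v ∉ M.verts, σ v = v := by
  have h : ∀ v, ∃ w, (v ∈ M.verts → M.Adj v w) ∧ (v ∉ M.verts → w = v) := by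
    intro v
    by_cases hv : v ∈ M.verts
    · obtain ⟨w, hw, -⟩ := hM hv
      exact ⟨w, fun _ => hw, fun h => absurd hv h⟩
    · exact ⟨v, fun h => absurd h hv, fun _ => rfl⟩
  choose σ h1 h2 using h
  refine ⟨σ, fun v => ?_, h1, h2⟩
  by_cases hv : v ∈ M.verts
  · have h3 := h1 v hv
    exact hM.eq_of_adj_left (h1 _ h3.snd_mem) h3.symm
  · rw [h2 v hv, h2 v hv]

theorem ncard_le_of_involutive [Finite α] {m : ℕ}
    (hmax : ∀ M : G.Subgraph, M.IsMatching → M.edgeSet.ncard ≤ m) {τ : α → α}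
    (hτ : τ.Involutive) (hadj : ∀ v, τ v ≠ v → G.Adj v (τ v)) : {v | τ v ≠ v}.ncard ≤ 2 * m := by
  let M : G.Subgraph :=
    { verts := {v | τ v ≠ v}
      Adj := fun a b => a ≠ b ∧ τ a = b
      adj_sub := by
        rintro a b ⟨hab, rfl⟩
        exact hadj a hab.symm
      edge_vert := by
        rintro a b ⟨hab, rfl⟩
        exact hab.symm
      symm := ⟨by
        rintro a b ⟨hab, rfl⟩
        exact ⟨hab.symm, hτ a⟩⟩ }
  have hM : M.IsMatching := fun v hv => ⟨τ v, ⟨Ne.symm hv, rfl⟩, fun w hw => hw.2.symm⟩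
  have h1 := two_mul_ncard_eq_of_isMatching hM subset_rfl
  rw [verts_eq_of_isMatching hM] at h1
  have h2 := hmax M hM
  change M.verts.ncard ≤ _
  omega

/-- `σ` exchanges the ends of the edges of a matching of `G` that admits no larger matching covering
all the vertices it covers. -/
structure IsMaxPartner (G : SimpleGraph α) (σ : α → α) : Prop where
  inv : σ.Involutive
  adj : ∀ v, σ v ≠ v → G.Adj v (σ v)
  max : ∀ τ : α → α, τ.Involutive → (∀ v, τ v ≠ v → G.Adj v (τ v)) → (∀ v, σ v ≠ v → τ v ≠ v) →
    ∀ x, σ x = x → τ x = x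

theorem IsMaxPartner.not_adj {σ : α → α} (h : IsMaxPartner G σ) {x x' : α} (hx : σ x = x)
    (hx' : σ x' = x') : ¬ G.Adj x x' := by
  classical
  intro hadj
  have hinv := h.inv
  have hG := h.adj
  have hne := hadj.ne
  have := h.max (fun v => if v = x then x' else if v = x' then x else σ v)
    (fun v => by have := hinv v; grind) (fun v => by have := hG v; have := hadj.symm; grind)
    (fun v => by grind) x hx
  grind

/-- Otherwise x, w, σ w, x' would be an augmenting path. -/
theorem IsMaxPartner.not_adj_partner {σ : α → α} (h : IsMaxPartner G σ) {x x' w : α}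
    (hx : σ x = x) (hx' : σ x' = x') (hne : x ≠ x') (hw : σ w ≠ w) (hxw : G.Adj x w) :
    ¬ G.Adj x' (σ w) := by
  classical
  intro hadj
  have hinv := h.inv
  have hG := h.adj
  have hww := hinv w
  have h1 := hadj.ne
  have h2 := hxw.ne
  have h3 := hxw.symm
  have h4 := hadj.symm
  have := h.max (fun v => if v = x then w else if v = w then x else if v = x' then σ w else
      if v = σ w then x' else σ v)
    (fun v => by have := hinv v; grind) (fun v => by have := hG v; grind)
    (fun v => by have := hinv v; grind) x hx
  grind

/-- Otherwise x, w, σ w, w', σ w', x' would be an augmenting path. -/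
theorem IsMaxPartner.not_adj_partner_of_adj {σ : α → α} (h : IsMaxPartner G σ) {x x' w w' : α}
    (hx : σ x = x) (hx' : σ x' = x') (hne : x ≠ x') (hw : σ w ≠ w) (hw' : σ w' ≠ w')
    (hww' : w' ≠ w) (hσ : w' ≠ σ w) (hxw : G.Adj x w) (hadj : G.Adj (σ w) w') :
    ¬ G.Adj x' (σ w') := by
  classical
  intro hadj'
  have hinv := h.inv
  have h0 := hinv w
  have h0' := hinv w'
  have h1 := hadj.symm
  have h2 := hxw.symm
  have h3 := hadj'.symm
  have := h.max (fun v => if v = x then w else if v = w then x else if v = x' then σ w' else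
      if v = σ w' then x' else if v = σ w then w' else if v = w' then σ w else σ v)
    (fun v => by have := hinv v; grind (splits := 30))
    (fun v => by have := h.adj v; grind (splits := 30))
    (fun v => by have := hinv v; grind (splits := 30)) x hx
  grind

end Matchings

end Digraph

namespace Digraph

/-! ### The structure of H when two vertices are missed. -/

section Structure

/-- `C` is closed under adjacency by arcs in both directions. -/
def IsBidirClosed {α : Type*} (H : Digraph α) (C : Set α) : Prop :=
  ∀ w ∈ C, ∀ v, H.Adj w v → H.Adj v w → v ∈ C

variable {α : Type*} [Finite α] {H : Digraph α} {m : ℕ} {σ : α → α}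

/-- If a vertex has only `m` possible neighbours and semi-degrees at least `m`, it is joined to and
from each of them. -/
theorem adj_of_neighborSet_subset (hout : ∀ v, m ≤ H.outDeg v) (hin : ∀ v, m ≤ H.inDeg v) {v : α}
    {T : Set α} (hT : H.UG.neighborSet v ⊆ T) (hcard : T.ncard ≤ m) :
    T.ncard = m ∧ ∀ u ∈ T, u ≠ v ∧ H.Adj v u ∧ H.Adj u v := by
  have h1 : H.outNbhd v ⊆ T := fun u hu => hT ⟨hu.1.symm, Or.inl hu.2⟩
  have h2 : H.inNbhd v ⊆ T := fun u hu => hT ⟨hu.1.symm, Or.inr hu.2⟩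
  have h3 : H.outNbhd v = T := Set.eq_of_subset_of_ncard_le h1 (hcard.trans (hout v))
  have h4 : H.inNbhd v = T := Set.eq_of_subset_of_ncard_le h2 (hcard.trans (hin v))
  refine ⟨le_antisymm hcard (h3 ▸ hout v), fun u hu => ?_⟩
  have h5 := hu
  rw [← h3] at hu
  rw [← h4] at h5
  exact ⟨hu.1, hu.2, h5.2⟩

theorem le_ncard_neighborSet (hout : ∀ v, m ≤ H.outDeg v) (v : α) :
    m ≤ (H.UG.neighborSet v).ncard :=
  (hout v).trans (Set.ncard_le_ncard fun _ hu => ⟨hu.1.symm, Or.inl hu.2⟩)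

/-- The neighbourhoods of two vertices `x`, `x'` missed by a maximum matching determine each
other. -/
theorem IsMaxPartner.neighborSet_eq (hσ : IsMaxPartner H.UG σ) (hcard : {v | σ v ≠ v}.ncard = 2 * m)
    (hout : ∀ v, m ≤ H.outDeg v) (hin : ∀ v, m ≤ H.inDeg v) {x x' : α} (hx : σ x = x)
    (hx' : σ x' = x') (hne : x ≠ x') :
    H.UG.neighborSet x' = {v | σ v ≠ v ∧ σ v ∉ H.UG.neighborSet x} ∧
      (H.UG.neighborSet x').ncard = m ∧ ∀ u ∈ H.UG.neighborSet x', H.Adj x' u ∧ H.Adj u x' := by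
  have hcov : ∀ {y v : α}, σ y = y → v ∈ H.UG.neighborSet y → σ v ≠ v :=
    fun hy hv h => hσ.not_adj hy h hv
  have hsub : H.UG.neighborSet x' ⊆ {v | σ v ≠ v ∧ σ v ∉ H.UG.neighborSet x} := by
    intro v hv
    have hv' := hcov hx' hv
    refine ⟨hv', fun h => ?_⟩
    refine hσ.not_adj_partner hx hx' hne (w := σ v) ?_ h ?_
    · rw [hσ.inv]
      exact hv'.symm
    · rw [hσ.inv]
      exact hv
  have hdisj : Disjoint {v | σ v ≠ v ∧ σ v ∉ H.UG.neighborSet x} (σ '' H.UG.neighborSet x) := by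
    rw [Set.disjoint_left]
    rintro _ ⟨-, hv⟩ ⟨w, hw, rfl⟩
    rw [hσ.inv] at hv
    exact hv hw
  -- The partners of N(x) take up at least m of the 2m covered vertices, leaving at most m for
  -- N(x').
  have hle : {v | σ v ≠ v ∧ σ v ∉ H.UG.neighborSet x} ∪ σ '' H.UG.neighborSet x ⊆
      {v | σ v ≠ v} := by
    rintro _ (hv | ⟨w, hw, rfl⟩)
    · exact hv.1
    · rw [Set.mem_ofPred_eq, hσ.inv]
      exact (hcov hx hw).symm
  have h1 := Set.ncard_le_ncard hle
  rw [Set.ncard_union_eq hdisj, Set.ncard_image_of_injective _ hσ.inv.injective, hcard] at h1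
  have h2 := le_ncard_neighborSet hout x
  obtain ⟨h3, h4⟩ := adj_of_neighborSet_subset hout hin hsub (by omega)
  have h5 : H.UG.neighborSet x' = {v | σ v ≠ v ∧ σ v ∉ H.UG.neighborSet x} :=
    hsub.antisymm fun v hv => ⟨(h4 v hv).1.symm, Or.inl (h4 v hv).2.1⟩
  exact ⟨h5, h5 ▸ h3, fun u hu => (h4 u (hsub hu)).2⟩

/-- The partner of `y` has at least m neighbours, all common to x and x', so N(x) = N(x') = N. Every
vertex outside N is then joined by 2-cycles to all of N, so `C` spreads from x to N and from `y` to
the rest. -/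
theorem IsMaxPartner.mem_of_common_neighbor (hσ : IsMaxPartner H.UG σ)
    (hcard : {v | σ v ≠ v}.ncard = 2 * m) (hout : ∀ v, m ≤ H.outDeg v)
    (hin : ∀ v, m ≤ H.inDeg v) {x x' y : α} (hx : σ x = x) (hx' : σ x' = x') (hne : x ≠ x')
    (hy : y ∈ H.UG.neighborSet x) (hy' : y ∈ H.UG.neighborSet x') {C : Set α}
    (hC : H.IsBidirClosed C) (hxC : x ∈ C) (v : α) : v ∈ C := by
  obtain ⟨hN', hN'card, hN'adj⟩ := hσ.neighborSet_eq hcard hout hin hx hx' hne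
  obtain ⟨hN, hNcard, hNadj⟩ := hσ.neighborSet_eq hcard hout hin hx' hx hne.symm
  have hcov : ∀ {y v : α}, σ y = y → v ∈ H.UG.neighborSet y → σ v ≠ v :=
    fun hy hv h => hσ.not_adj hy h hv
  -- A partner of a common neighbour has all its neighbours among the common neighbours.
  have hkey : ∀ w, σ w ≠ w → σ w ∈ H.UG.neighborSet x → σ w ∈ H.UG.neighborSet x' →
      H.UG.neighborSet w ⊆ H.UG.neighborSet x ∩ H.UG.neighborSet x' := by
    intro w hw hwx hwx' v hv
    have hσσ : σ (σ w) ≠ σ w := by rw [hσ.inv]; exact hw.symm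
    -- If v were missed, v, w, σ w followed by x or x', whichever differs from v, would be
    -- augmenting.
    have hvcov : σ v ≠ v := by
      intro hvfix
      have hadj : H.UG.Adj v (σ (σ w)) := by rw [hσ.inv]; exact SimpleGraph.Adj.symm hv
      by_cases hvx : x = v
      · exact hσ.not_adj_partner hx' hvfix (by rw [← hvx]; exact hne.symm) hσσ hwx' hadj
      · exact hσ.not_adj_partner hx hvfix hvx hσσ hwx hadj
    by_cases hvw : v = σ w
    · rw [hvw]
      exact ⟨hwx, hwx'⟩
    have hvw' : v ≠ σ (σ w) := by
      rw [hσ.inv]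
      exact (SimpleGraph.Adj.ne (G := H.UG) hv).symm
    have hadj : H.UG.Adj (σ (σ w)) v := by rw [hσ.inv]; exact hv
    constructor
    · rw [hN]
      exact ⟨hvcov, hσ.not_adj_partner_of_adj hx hx' hne hσσ hvcov hvw hvw' hwx hadj⟩
    · rw [hN']
      exact ⟨hvcov, hσ.not_adj_partner_of_adj hx' hx hne.symm hσσ hvcov hvw hvw' hwx' hadj⟩
  have hyσ : σ (σ y) = y := hσ.inv y
  have hyy : σ (σ y) ≠ σ y := by rw [hyσ]; exact (hcov hx hy).symm
  have hsub := hkey (σ y) hyy (by rwa [hyσ]) (by rwa [hyσ])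
  have hle : m ≤ (H.UG.neighborSet x ∩ H.UG.neighborSet x').ncard :=
    (le_ncard_neighborSet hout (σ y)).trans (Set.ncard_le_ncard hsub)
  have heq1 : H.UG.neighborSet x ∩ H.UG.neighborSet x' = H.UG.neighborSet x :=
    Set.eq_of_subset_of_ncard_le Set.inter_subset_left (by omega)
  have heq2 : H.UG.neighborSet x ∩ H.UG.neighborSet x' = H.UG.neighborSet x' :=
    Set.eq_of_subset_of_ncard_le Set.inter_subset_right (by omega)
  have heq : H.UG.neighborSet x = H.UG.neighborSet x' := heq1.symm.trans heq2
  have hNC : ∀ u ∈ H.UG.neighborSet x, u ∈ C :=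
    fun u hu => hC x hxC u (hNadj u hu).1 (hNadj u hu).2
  by_cases hvN : v ∈ H.UG.neighborSet x
  · exact hNC v hvN
  refine hC y (hNC y hy) v ?_ ?_ <;> by_cases hv : σ v = v
  · by_cases hvx : x = v
    · rw [← hvx]
      exact (hNadj y hy).2
    · obtain ⟨h1, -, h3⟩ := hσ.neighborSet_eq hcard hout hin hx hv hvx
      exact (h3 y (by rw [h1, ← hN']; exact hy')).2
  · have hσv : σ v ∈ H.UG.neighborSet x := by
      by_contra h
      exact hvN (heq ▸ (hN'.symm ▸ ⟨hv, h⟩ : v ∈ H.UG.neighborSet x'))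
    have h := hkey v hv hσv (heq ▸ hσv)
    rw [heq1] at h
    exact ((adj_of_neighborSet_subset hout hin h hNcard.le).2 y hy).2.2
  · by_cases hvx : x = v
    · rw [← hvx]
      exact (hNadj y hy).1
    · obtain ⟨h1, -, h3⟩ := hσ.neighborSet_eq hcard hout hin hx hv hvx
      exact (h3 y (by rw [h1, ← hN']; exact hy')).1
  · have hσv : σ v ∈ H.UG.neighborSet x := by
      by_contra h
      exact hvN (heq ▸ (hN'.symm ▸ ⟨hv, h⟩ : v ∈ H.UG.neighborSet x'))
    have h := hkey v hv hσv (heq ▸ hσv)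
    rw [heq1] at h
    exact ((adj_of_neighborSet_subset hout hin h hNcard.le).2 y hy).2.1

theorem IsMaxPartner.partner_mem (hσ : IsMaxPartner H.UG σ)
    (hcard : {v | σ v ≠ v}.ncard = 2 * m) (hout : ∀ v, m ≤ H.outDeg v)
    (hin : ∀ v, m ≤ H.inDeg v) {x x' : α} (hx : σ x = x) (hx' : σ x' = x') (hne : x ≠ x')
    (hdisj : Disjoint (H.UG.neighborSet x) (H.UG.neighborSet x')) {v : α}
    (hv : v ∈ H.UG.neighborSet x) : σ v ∈ H.UG.neighborSet x := by
  obtain ⟨hN', -, -⟩ := hσ.neighborSet_eq hcard hout hin hx hx' hne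
  by_contra h
  refine Set.disjoint_left.mp hdisj hv ?_
  rw [hN']
  exact ⟨fun hfix => hσ.not_adj hx hfix hv, h⟩

/-- A third missed vertex would have neighbourhood N(x') when compared with x and N(x) when compared
with x', but these are disjoint and nonempty. -/
theorem IsMaxPartner.eq_or_eq_or_mem (hσ : IsMaxPartner H.UG σ) (hm : 0 < m)
    (hcard : {v | σ v ≠ v}.ncard = 2 * m) (hout : ∀ v, m ≤ H.outDeg v)
    (hin : ∀ v, m ≤ H.inDeg v) {x x' : α} (hx : σ x = x) (hx' : σ x' = x') (hne : x ≠ x')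
    (hdisj : Disjoint (H.UG.neighborSet x) (H.UG.neighborSet x')) (v : α) :
    (v = x ∨ v = x') ∨ σ v ≠ v ∧ (v ∈ H.UG.neighborSet x ∨ v ∈ H.UG.neighborSet x') := by
  obtain ⟨hN', hN'card, -⟩ := hσ.neighborSet_eq hcard hout hin hx hx' hne
  obtain ⟨hN, -, -⟩ := hσ.neighborSet_eq hcard hout hin hx' hx hne.symm
  by_cases hv : σ v = v
  · left
    by_contra! h
    have h1 := (hσ.neighborSet_eq hcard hout hin hx hv h.1.symm).1
    have h2 := (hσ.neighborSet_eq hcard hout hin hx' hv h.2.symm).1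
    rw [← hN'] at h1
    rw [← hN, h1] at h2
    rw [h2, disjoint_self] at hdisj
    rw [h2, hdisj] at hN'card
    simp at hN'card
    omega
  · right
    refine ⟨hv, ?_⟩
    by_contra! h
    have h1 : σ v ∈ H.UG.neighborSet x := by
      by_contra h1
      exact h.2 (hN'.symm ▸ ⟨hv, h1⟩)
    exact h.1 (hσ.inv v ▸ hσ.partner_mem hcard hout hin hx hx' hne hdisj h1)

/-- If `x`, `x'` have no common neighbour, then `x` and its neighbours form a complete digraph. -/
theorem IsMaxPartner.adj_of_disjoint (hσ : IsMaxPartner H.UG σ) (hm : 0 < m)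
    (hcard : {v | σ v ≠ v}.ncard = 2 * m) (hout : ∀ v, m ≤ H.outDeg v)
    (hin : ∀ v, m ≤ H.inDeg v) {x x' : α} (hx : σ x = x) (hx' : σ x' = x') (hne : x ≠ x')
    (hdisj : Disjoint (H.UG.neighborSet x) (H.UG.neighborSet x')) {a b : α}
    (ha : a ∈ insert x (H.UG.neighborSet x)) (hb : b ∈ insert x (H.UG.neighborSet x))
    (hab : b ≠ a) : H.Adj a b ∧ H.Adj b a := by
  obtain ⟨-, hNcard, -⟩ := hσ.neighborSet_eq hcard hout hin hx' hx hne.symm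
  have hA : (insert x (H.UG.neighborSet x)).ncard = m + 1 := by
    rw [Set.ncard_insert_of_notMem (fun h : x ∈ H.UG.neighborSet x => H.UG.irrefl h), hNcard]
  have hAa := Set.ncard_sdiff_singleton_of_mem ha
  have hsub : H.UG.neighborSet a ⊆ insert x (H.UG.neighborSet x) \ {a} := by
    intro u hu
    refine ⟨?_, fun h => SimpleGraph.Adj.ne (G := H.UG) hu (Eq.symm h)⟩
    rcases ha with rfl | ha
    · exact Or.inr hu
    rcases hσ.eq_or_eq_or_mem hm hcard hout hin hx hx' hne hdisj u with (h | h) | ⟨hucov, h | h⟩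
    · exact Or.inl h
    · rw [h] at hu
      exact absurd (SimpleGraph.Adj.symm (G := H.UG) hu) (Set.disjoint_left.mp hdisj ha)
    · exact Or.inr h
    -- An edge from N(x) to N(x') would give the augmenting path x, σ a, a, u, σ u, x'.
    · exfalso
      have hacov : σ a ≠ a := fun hfix => hσ.not_adj hx hfix ha
      have h1 := hσ.partner_mem hcard hout hin hx hx' hne hdisj ha
      have h2 := hσ.partner_mem hcard hout hin hx' hx hne.symm hdisj.symm h
      refine hσ.not_adj_partner_of_adj hx hx' hne (w := σ a) (w' := u) ?_ hucov ?_ ?_ h1 ?_ h2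
      · rw [hσ.inv]
        exact hacov.symm
      · rintro rfl
        exact Set.disjoint_left.mp hdisj h1 h
      · rw [hσ.inv]
        exact (SimpleGraph.Adj.ne (G := H.UG) hu).symm
      · rw [hσ.inv]
        exact hu
  exact ((adj_of_neighborSet_subset hout hin hsub (by omega)).2 b ⟨hb, hab⟩).2

/-- Two complete digraphs cover H. Being nonadjacent, a and b lie in different ones, so `C` meets
both and fills them. -/
theorem IsMaxPartner.mem_of_disjoint (hσ : IsMaxPartner H.UG σ) (hm : 0 < m)
    (hcard : {v | σ v ≠ v}.ncard = 2 * m) (hout : ∀ v, m ≤ H.outDeg v)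
    (hin : ∀ v, m ≤ H.inDeg v) {x x' : α} (hx : σ x = x) (hx' : σ x' = x') (hne : x ≠ x')
    (hdisj : Disjoint (H.UG.neighborSet x) (H.UG.neighborSet x')) {C : Set α}
    (hC : H.IsBidirClosed C) {a b : α} (ha : a ∈ C) (hb : b ∈ C) (hab : a ≠ b)
    (hnadj : ¬ H.IsAdjacent a b) (v : α) : v ∈ C := by
  have hcov : ∀ v, v ∈ insert x (H.UG.neighborSet x) ∨ v ∈ insert x' (H.UG.neighborSet x') := by
    intro v
    rcases hσ.eq_or_eq_or_mem hm hcard hout hin hx hx' hne hdisj v with (h | h) | ⟨-, h | h⟩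
    · exact Or.inl (Or.inl h)
    · exact Or.inr (Or.inl h)
    · exact Or.inl (Or.inr h)
    · exact Or.inr (Or.inr h)
  have hK : ∀ {a b : α}, a ∈ insert x (H.UG.neighborSet x) → b ∈ insert x (H.UG.neighborSet x) →
      b ≠ a → H.Adj a b ∧ H.Adj b a :=
    fun ha hb hab => hσ.adj_of_disjoint hm hcard hout hin hx hx' hne hdisj ha hb hab
  have hK' : ∀ {a b : α}, a ∈ insert x' (H.UG.neighborSet x') →
      b ∈ insert x' (H.UG.neighborSet x') → b ≠ a → H.Adj a b ∧ H.Adj b a :=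
    fun ha hb hab => hσ.adj_of_disjoint hm hcard hout hin hx' hx hne.symm hdisj.symm ha hb hab
  have hfill : ∀ {c}, c ∈ C → (v ≠ c → H.Adj c v ∧ H.Adj v c) → v ∈ C := by
    intro c hc h
    by_cases hvc : v = c
    · rwa [hvc]
    · exact hC c hc v (h hvc).1 (h hvc).2
  rcases hcov a with h1 | h1 <;> rcases hcov b with h2 | h2
  · exact absurd (Or.inl (hK h1 h2 hab.symm).1) hnadj
  · rcases hcov v with h | h
    · exact hfill ha (hK h1 h)
    · exact hfill hb (hK' h2 h)
  · rcases hcov v with h | h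
    · exact hfill hb (hK h2 h)
    · exact hfill ha (hK' h1 h)
  · exact absurd (Or.inl (hK' h1 h2 hab.symm).1) hnadj

end Structure

end Digraph

/-! ### The main theorem. -/

open Digraph in
theorem mainTheorem2 {V : Type*} [Finite V] (D : Digraph V) (hD : ∀ v, ¬ D.Adj v v)
    (S : Set V) (M : (D.inducedOn S).UG.Subgraph) (m : ℕ)
    (hM : (D.inducedOn S).IsMaximumMatching M) (hcard : M.edgeSet.ncard = m) (hm : 0 < m)
    (hexc : ∀ x x' : S, x ≠ x' → M.vertsᶜ = {x, x'} →
      (2 * ((D.inducedOn S).matchingEdgesAt M x).ncard = m ∨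
        2 * ((D.inducedOn S).matchingEdgesAt M x').ncard = m) →
      D.IsStrictlyStrong S)
    (hdeg : m ≤ (D.inducedOn S).minSemidegree) :
    D.IsClosedTrailable S := by
  obtain ⟨hmatch, hmax⟩ := hM
  have hout : ∀ v, m ≤ (D.inducedOn S).outDeg v := fun v =>
    (hdeg.trans (min_le_left _ _)).trans (ciInf_le (OrderBot.bddBelow _) v)
  have hin : ∀ v, m ≤ (D.inducedOn S).inDeg v := fun v =>
    (hdeg.trans (min_le_right _ _)).trans (ciInf_le (OrderBot.bddBelow _) v)
  have hverts : 2 * m = M.verts.ncard := by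
    rw [← hcard, two_mul_ncard_eq_of_isMatching hmatch subset_rfl, verts_eq_of_isMatching hmatch]
  obtain ⟨σ, hinv, hadj, hfix⟩ := exists_partner hmatch
  have hσverts : {v | σ v ≠ v} = M.verts := by
    ext v
    refine ⟨fun h => ?_, fun h => (hadj v h).ne.symm⟩
    by_contra hv
    exact h (hfix v hv)
  have hσcard : {v | σ v ≠ v}.ncard = 2 * m := by rw [hσverts, hverts]
  have hσ : IsMaxPartner (D.inducedOn S).UG σ := by
    refine ⟨hinv, fun v hv => (hadj v (hσverts ▸ hv)).adj_sub, fun τ h1 h2 h3 x hx => ?_⟩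
    by_contra hτx
    have h4 := ncard_le_of_involutive (m := m) (fun M' h => hcard ▸ hmax M' h) h1 h2
    have h5 : {v | σ v ≠ v}.ncard < {v | τ v ≠ v}.ncard :=
      Set.ncard_lt_ncard ⟨h3, fun h => h hτx hx⟩
    omega
  have hnefix : ∀ {x}, x ∉ M.verts → σ x = x := fun {x} hx => hfix x hx
  have hclosed : ∀ {u : V} (Q : D.DiWalk u u), (∀ w ∈ Q.support, ∀ v, D.Adj w v → D.Adj v w →
      v ∈ Q.support) → (D.inducedOn S).IsBidirClosed {v | (v : V) ∈ Q.support} :=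
    fun Q h w hw v hwv hvw => h w hw v hwv hvw
  rcases Nat.lt_or_ge 1 M.vertsᶜ.ncard with hX | hX
  · obtain ⟨x, x', hx, hx', hne⟩ := (Set.one_lt_ncard_iff (Set.toFinite _)).mp hX
    have hx := hnefix hx
    have hx' := hnefix hx'
    by_cases hdisj : Disjoint ((D.inducedOn S).UG.neighborSet x)
        ((D.inducedOn S).UG.neighborSet x')
    · have htri := hσ.eq_or_eq_or_mem hm hσcard hout hin hx hx' hne hdisj
      have hXeq : M.vertsᶜ = {x, x'} := by
        ext v
        rw [← hσverts]
        constructor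
        · intro hv
          rcases htri v with h | h
          · exact h
          · exact absurd h.1 hv
        · rintro (rfl | rfl) h
          · exact h hx
          · exact h hx'
      -- Partners of vertices of N(x) stay in N(x), so the edges of M_x cover exactly the m vertices
      -- of N(x).
      have hMx : 2 * ((D.inducedOn S).matchingEdgesAt M x).ncard = m := by
        rw [two_mul_ncard_eq_of_isMatching hmatch fun e he => he.1]
        rw [← (hσ.neighborSet_eq hσcard hout hin hx' hx hne.symm).2.1]
        congr 1
        ext v
        constructor
        · rintro ⟨e, ⟨he, u, hue, hux⟩, w, rfl⟩
          have hvw : M.Adj v w := he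
          have hwσ : w = σ v := hmatch.eq_of_adj_left hvw (hadj v (M.edge_vert hvw))
          have huN : u ∈ (D.inducedOn S).UG.neighborSet x := by
            refine ⟨?_, hux.symm⟩
            rintro rfl
            exact hux.elim (hD _) (hD _)
          rcases Sym2.mem_iff.mp hue with rfl | rfl
          · exact huN
          · have := hσ.partner_mem hσcard hout hin hx hx' hne hdisj huN
            rwa [hwσ, hinv] at this
        · intro hv
          have hvM : v ∈ M.verts := by
            rw [← hσverts]
            exact fun h => hσ.not_adj hx h hv
          exact ⟨s(v, σ v), ⟨hadj v hvM, v, Sym2.mem_mk_left _ _, hv.2.symm⟩, Sym2.mem_mk_left _ _⟩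
      obtain ⟨a, ha, b, hb, hab, hnadj, u, Q, hQ, hQab⟩ := hexc x x' hne hXeq (Or.inl hMx)
      obtain ⟨Q', hQ', hsup, hsat⟩ := exists_closed_ditrail_saturated hD Q hQ
      refine ⟨u, Q', hQ', fun v hv => ?_⟩
      exact hσ.mem_of_disjoint hm hσcard hout hin hx hx' hne hdisj (hclosed Q' hsat)
        (a := ⟨a, ha⟩) (b := ⟨b, hb⟩) (hsup a (hQab a (by simp))) (hsup b (hQab b (by simp)))
        (fun h => hab (congrArg Subtype.val h)) hnadj ⟨v, hv⟩
    · obtain ⟨y, hy, hy'⟩ := Set.not_disjoint_iff.mp hdisj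
      -- Here the trivial ditrail at `x` is enough to start from.
      obtain ⟨Q', hQ', hsup, hsat⟩ :=
        exists_closed_ditrail_saturated hD (DiWalk.nil (D := D) (x : V)) List.nodup_nil
      refine ⟨x, Q', hQ', fun v hv => ?_⟩
      exact hσ.mem_of_common_neighbor hσcard hout hin hx hx' hne hy hy' (hclosed Q' hsat)
        (hsup x (by simp [DiWalk.support])) ⟨v, hv⟩
  · have hn := Set.ncard_add_ncard_compl M.verts
    have : Nonempty S := (Nat.card_pos_iff.mp (by omega)).1
    exact isClosedTrailable_of_natCard_le hD hm (by omega) hout hin
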